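/- Let $\mathbb{F}$ be $\mathbb{R}$ or $\mathbb{C}$, and let $a\mapsto\overline a$ be the identity on $\mathbb{R}$ and complex conjugation on $\mathbb{C}$. Let $(\cdot)^\star$ denote the conjugate transpose (over $\mathbb{R}$: the transpose); conjugation and $(\cdot)^\star$ act on matrix polynomials coefficientwise. For $A=\begin{bmatrix} a&b\\ c&d\end{bmatrix}\in \mathrm{GL}(2,\mathbb{F})$ and a matrix polynomial $B(\lambda)=\sum_{i=0}^g B_i\lambda^i$ of grade $g$ (some of the $B_i$, including $B_g$, may be zero), the Möbius transformation of $B$ induced by $A$ is $$\mathbf{M}_A[B](\lambda)=\sum_{i=0}^g B_i(a\lambda+b)^i(c\lambda+d)^{g-i}.$$ A matrix polynomial $P(\lambda)\in\mathbb{F}[\lambda]^{n\times n}$ of grade $g$ is $\mathbf{M}_A$-structured if $\mathbf{M}_A[P](\lambda)=P(\lambda)^\star$, and singular if $\det P(\lambda)$ is identically zero. Put $\mathcal{N}_r(P)=\{x\in\mathbb{F}(\lambda)^{n\times 1}: Px=0\}$ and $\mathcal{N}_\ell(P)=\{y^T\in\mathbb{F}(\lambda)^{1\times n}: y^TP=0\}$.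 A minimal basis of a subspace of $\mathbb{F}(\lambda)^n$ is a basis consisting of vector polynomials for which the sum of the degrees of its vectors is least among all such bases; all minimal bases of a subspace have the same list of degrees, counted with multiplicity, and these degrees are its minimal indices. The right (left) minimal indices of $P$ are the minimal indices of $\mathcal{N}_r(P)$ (of $\mathcal{N}_\ell(P)$). **Theorem.** Let $A\in\mathrm{GL}(2,\mathbb{F})$ and let $P(\lambda)\in\mathbb{F}[\lambda]^{n\times n}$ be a singular $\mathbf{M}_A$-structured matrix polynomial of grade $g$. Then the right and left minimal indices of $P(\lambda)$ are equal, as multisets. Furthermore, if $\{x_1(\lambda),\dots,x_p(\lambda)\}$ is a minimal basis of $\mathcal{N}_r(P)$, then the transposes of $\mathbf{M}_{\overline A}[\overline{x}_1](\lambda),\dots,\mathbf{M}_{\overline A}[\overline{x}_p](\lambda)$ form a minimal basis of $\mathcal{N}_\ell(P)$, where each $\mathbf{M}_{\overline A}[\overline{x}_i]$ is taken with respect to the grade $\deg x_i$. -/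

import Mathlib

open Polynomial

noncomputable section

namespace MobiusPoly

/-! ## Vector polynomials and minimal bases of rational subspaces -/

section Field

variable {K : Type*} [Field K]

/-- The degree of a vector polynomial: the largest degree of its entries. -/
def vecDegree {n : ℕ} (x : Fin n → K[X]) : ℕ :=
  Finset.univ.sup fun j => (x j).natDegree

/-- A vector polynomial, seen as a vector of rational functions. -/
def toRat {n : ℕ} (x : Fin n → K[X]) : Fin n → RatFunc K :=
  fun j => algebraMap K[X] (RatFunc K) (x j)

/-- The family `x₁, …, x_p` of vector polynomials is a basis of the rational subspace `V`. -/
def IsPolynomialBasis {n p : ℕ} (V : Submodule (RatFunc K) (Fin n → RatFunc K))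
    (x : Fin p → Fin n → K[X]) : Prop :=
  LinearIndependent (RatFunc K) (fun i => toRat (x i)) ∧
    Submodule.span (RatFunc K) (Set.range fun i => toRat (x i)) = V

/-- The order of a polynomial basis: the sum of the degrees of its vectors. -/
def order {n p : ℕ} (x : Fin p → Fin n → K[X]) : ℕ :=
  ∑ i, vecDegree (x i)

/-- A minimal basis of `V`: a polynomial basis of `V` of least order among all of them. -/
def IsMinimalBasis {n p : ℕ} (V : Submodule (RatFunc K) (Fin n → RatFunc K))
    (x : Fin p → Fin n → K[X]) : Prop :=
  IsPolynomialBasis V x ∧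
    ∀ (q : ℕ) (y : Fin q → Fin n → K[X]), IsPolynomialBasis V y → order x ≤ order y

/-- The degrees of the vectors of a family, counted with multiplicity. -/
def degrees {n p : ℕ} (x : Fin p → Fin n → K[X]) : Multiset ℕ :=
  Finset.univ.val.map fun i => vecDegree (x i)

/-- Every rational subspace has a basis of vector polynomials. -/
theorem exists_isPolynomialBasis {n : ℕ} (V : Submodule (RatFunc K) (Fin n → RatFunc K)) :
    ∃ (p : ℕ) (x : Fin p → Fin n → K[X]), IsPolynomialBasis V x := by
  classical
  let b := Module.finBasis (RatFunc K) V
  obtain ⟨d, hd⟩ := IsLocalization.exist_integer_multiples_of_finset (nonZeroDivisors K[X])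
    (Finset.univ.image fun ij : Fin (Module.finrank (RatFunc K) V) × Fin n =>
      (b ij.1 : Fin n → RatFunc K) ij.2)
  have hd' : ∀ i j, ∃ q : K[X], algebraMap K[X] (RatFunc K) q =
      (d : K[X]) • (b i : Fin n → RatFunc K) j := fun i j =>
    hd _ (Finset.mem_image.2 ⟨(i, j), Finset.mem_univ _, rfl⟩)
  choose x hx using hd'
  have hd0 : algebraMap K[X] (RatFunc K) (d : K[X]) ≠ 0 :=
    IsFractionRing.to_map_ne_zero_of_mem_nonZeroDivisors d.2
  let u : (RatFunc K)ˣ := Units.mk0 _ hd0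
  have hb : LinearIndependent (RatFunc K) fun i => (b i : Fin n → RatFunc K) :=
    b.linearIndependent.map' V.subtype V.ker_subtype
  have hxe : (fun i => toRat (x i)) =
      (fun _ => u : Fin (Module.finrank (RatFunc K) V) → (RatFunc K)ˣ) • fun i => (b i : Fin n → RatFunc K) := by
    funext i j
    simp [toRat, hx, u, Algebra.smul_def, Units.smul_def]
  refine ⟨_, x, ?_, ?_⟩
  · rw [hxe]; exact hb.units_smul _
  · have hspan : Submodule.span (RatFunc K)
        (Set.range fun i => (b i : Fin n → RatFunc K)) = V := by
      have := congrArg (Submodule.map V.subtype) b.span_eq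
      rw [Submodule.map_span, ← Set.range_comp, Submodule.map_top, Submodule.range_subtype] at this
      exact this
    rw [hxe]
    refine le_antisymm ?_ ?_
    · rw [Submodule.span_le]
      rintro _ ⟨i, rfl⟩
      exact V.smul_mem _ (b i).2
    · conv_lhs => rw [← hspan]
      rw [Submodule.span_le]
      rintro _ ⟨i, rfl⟩
      have h1 : ((fun _ => u : Fin (Module.finrank (RatFunc K) V) → (RatFunc K)ˣ) • fun i => (b i : Fin n → RatFunc K)) i ∈
        Submodule.span (RatFunc K) (Set.range
          ((fun _ => u : Fin (Module.finrank (RatFunc K) V) → (RatFunc K)ˣ) • fun i => (b i : Fin n → RatFunc K))) :=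
        Submodule.subset_span ⟨i, rfl⟩
      have h2 := Submodule.smul_mem _ ((u⁻¹ : (RatFunc K)ˣ) : RatFunc K) h1
      simpa [Units.smul_def, smul_smul] using h2

/-- Every rational subspace has a minimal basis. -/
theorem exists_isMinimalBasis {n : ℕ} (V : Submodule (RatFunc K) (Fin n → RatFunc K)) :
    ∃ (p : ℕ) (x : Fin p → Fin n → K[X]), IsMinimalBasis V x := by
  classical
  have h : ∃ (k p : ℕ) (x : Fin p → Fin n → K[X]), IsPolynomialBasis V x ∧ order x = k := by
    obtain ⟨p, x, hx⟩ := exists_isPolynomialBasis V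
    exact ⟨_, p, x, hx, rfl⟩
  obtain ⟨p, x, hx, hk⟩ := Nat.find_spec h
  exact ⟨p, x, hx, fun q y hy => hk ▸ Nat.find_min' h ⟨q, y, hy, rfl⟩⟩

/-- A vector polynomial of degree at most `k` in `V` is spanned by the vectors of degree at most
`k` of any minimal basis of `V`. -/
theorem IsMinimalBasis.mem_span {n p : ℕ} {V : Submodule (RatFunc K) (Fin n → RatFunc K)}
    {x : Fin p → Fin n → K[X]} (hx : IsMinimalBasis V x) {k : ℕ} {v : Fin n → K[X]}
    (hv : toRat v ∈ V) (hk : vecDegree v ≤ k) :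
    toRat v ∈ Submodule.span (RatFunc K) ((fun i => toRat (x i)) '' {i | vecDegree (x i) ≤ k}) := by
  classical
  obtain ⟨⟨hli, hsp⟩, hmin⟩ := hx
  rw [← hsp, Submodule.mem_span_range_iff_exists_fun] at hv
  obtain ⟨c, hc⟩ := hv
  by_cases hall : ∀ i, c i ≠ 0 → vecDegree (x i) ≤ k
  · rw [← hc]
    refine Submodule.sum_mem _ fun i _ => ?_
    by_cases h0 : c i = 0
    · simp [h0]
    · exact Submodule.smul_mem _ _ (Submodule.subset_span ⟨i, hall i h0, rfl⟩)
  · exfalso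
    push Not at hall
    obtain ⟨i, hi0, hik⟩ := hall
    have hupd : (fun l => toRat (Function.update x i v l)) =
        Function.update (fun l => toRat (x l)) i (toRat v) := by
      funext l
      by_cases h : l = i
      · subst h; simp
      · simp [h]
    have hbasis : IsPolynomialBasis V (Function.update x i v) := by
      have hspan : V ≤ Submodule.span (RatFunc K)
          (Set.range fun l => toRat (Function.update x i v l)) := by
        have hmem : ∀ l, l ≠ i → toRat (x l) ∈ Submodule.span (RatFunc K)
            (Set.range fun l => toRat (Function.update x i v l)) := fun l hl =>
          Submodule.subset_span ⟨l, by simp [hl]⟩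
        have hvm : toRat v ∈ Submodule.span (RatFunc K)
            (Set.range fun l => toRat (Function.update x i v l)) :=
          Submodule.subset_span ⟨i, by simp⟩
        rw [← hsp, Submodule.span_le]
        rintro _ ⟨l, rfl⟩
        by_cases hl : l = i
        · subst hl
          rw [← Finset.add_sum_erase _ _ (Finset.mem_univ l)] at hc
          have h1 : c l • toRat (x l) =
              toRat v - ∑ m ∈ Finset.univ.erase l, c m • toRat (x m) := by
            rw [← hc]; simp
          have h2 : c l • toRat (x l) ∈ Submodule.span (RatFunc K)
              (Set.range fun m => toRat (Function.update x l v m)) := by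
            rw [h1]
            exact Submodule.sub_mem _ hvm (Submodule.sum_mem _ fun m hm =>
              Submodule.smul_mem _ _ (hmem m (Finset.ne_of_mem_erase hm)))
          simpa [smul_smul, hi0] using Submodule.smul_mem _ (c l)⁻¹ h2
        · exact hmem l hl
      have hle : Submodule.span (RatFunc K)
          (Set.range fun l => toRat (Function.update x i v l)) ≤ V := by
        rw [Submodule.span_le]
        rintro _ ⟨l, rfl⟩
        by_cases hl : l = i
        · subst hl
          simp only [Function.update_self]
          rw [← hc, ← hsp]
          exact Submodule.sum_mem _ fun m _ =>
            Submodule.smul_mem _ _ (Submodule.subset_span ⟨m, rfl⟩)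
        · rw [← hsp]
          exact Submodule.subset_span ⟨l, by simp [hl]⟩
      have heq := le_antisymm hle hspan
      refine ⟨?_, heq⟩
      rw [linearIndependent_iff_card_eq_finrank_span, Set.finrank, heq, ← hsp]
      exact linearIndependent_iff_card_eq_finrank_span.1 hli
    have hlt : order (Function.update x i v) < order x := by
      unfold order
      refine Finset.sum_lt_sum (fun l _ => ?_) ⟨i, Finset.mem_univ _, ?_⟩
      · by_cases hl : l = i
        · subst hl; simp; omega
        · simp [hl]
      · simp; omega
    exact absurd (hmin _ _ hbasis) (not_le.2 hlt)

theorem IsMinimalBasis.card_le {n p q : ℕ} {V : Submodule (RatFunc K) (Fin n → RatFunc K)}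
    {x : Fin p → Fin n → K[X]} {y : Fin q → Fin n → K[X]}
    (hx : IsMinimalBasis V x) (hy : IsMinimalBasis V y) (k : ℕ) :
    (Finset.univ.filter fun j => vecDegree (y j) ≤ k).card ≤
      (Finset.univ.filter fun i => vecDegree (x i) ≤ k).card := by
  classical
  have key : ∀ {r : ℕ} {z : Fin r → Fin n → K[X]}, IsMinimalBasis V z →
      Module.finrank (RatFunc K) (Submodule.span (RatFunc K)
        ((fun i => toRat (z i)) '' {i | vecDegree (z i) ≤ k})) =
      (Finset.univ.filter fun i => vecDegree (z i) ≤ k).card := by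
    intro r z hz
    have h := hz.1.1.comp (Subtype.val : {i // vecDegree (z i) ≤ k} → Fin r)
      Subtype.val_injective
    have h2 := finrank_span_eq_card h
    rw [Fintype.card_subtype] at h2
    rw [← h2, Set.range_comp, Subtype.range_coe_subtype]
  rw [← key hx, ← key hy]
  refine Submodule.finrank_mono ?_
  rw [Submodule.span_le]
  rintro _ ⟨j, hj, rfl⟩
  refine hx.mem_span ?_ hj
  rw [← hy.1.2]
  exact Submodule.subset_span ⟨j, rfl⟩

/-- All minimal bases of a rational subspace have the same degrees. -/
theorem IsMinimalBasis.degrees_eq {n p q : ℕ} {V : Submodule (RatFunc K) (Fin n → RatFunc K)}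
    {x : Fin p → Fin n → K[X]} {y : Fin q → Fin n → K[X]}
    (hx : IsMinimalBasis V x) (hy : IsMinimalBasis V y) : degrees x = degrees y := by
  classical
  have hle : ∀ k, (Finset.univ.filter fun i => vecDegree (x i) ≤ k).card =
      (Finset.univ.filter fun j => vecDegree (y j) ≤ k).card := fun k =>
    le_antisymm (hy.card_le hx k) (hx.card_le hy k)
  have hsplit : ∀ {r : ℕ} (z : Fin r → Fin n → K[X]) (k : ℕ),
      (Finset.univ.filter fun i => vecDegree (z i) ≤ k + 1).card =
      (Finset.univ.filter fun i => vecDegree (z i) ≤ k).card +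
      (Finset.univ.filter fun i => k + 1 = vecDegree (z i)).card := by
    intro r z k
    rw [← Finset.card_union_of_disjoint]
    · congr 1; ext i; simp; omega
    · rw [Finset.disjoint_left]; intro i; simp; omega
  ext k
  simp only [degrees, Multiset.count_map]
  change (Finset.univ.filter fun i => k = vecDegree (x i)).card =
    (Finset.univ.filter fun i => k = vecDegree (y i)).card
  cases k with
  | zero => simpa [eq_comm] using hle 0
  | succ k =>
    have h1 := hle k
    have h2 := hle (k + 1)
    rw [hsplit, hsplit] at h2
    omega

/-- The minimal indices of a rational subspace `V`: the list (up to order, with multiplicity) of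
the degrees of the vectors in a minimal basis of `V`. -/
def minimalIndices {n : ℕ} (V : Submodule (RatFunc K) (Fin n → RatFunc K)) : Multiset ℕ :=
  degrees (exists_isMinimalBasis V).choose_spec.choose

/-- The minimal indices are the degrees of any minimal basis. -/
theorem IsMinimalBasis.degrees_eq_minimalIndices {n p : ℕ}
    {V : Submodule (RatFunc K) (Fin n → RatFunc K)} {x : Fin p → Fin n → K[X]}
    (hx : IsMinimalBasis V x) : degrees x = minimalIndices V :=
  hx.degrees_eq (exists_isMinimalBasis V).choose_spec.choose_spec

/-! ## Matrix polynomials -/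

/-- The right rational null space `{x | P x = 0}`. -/
def rightNullSpace {m n : ℕ} (P : Matrix (Fin m) (Fin n) K[X]) :
    Submodule (RatFunc K) (Fin n → RatFunc K) :=
  LinearMap.ker (P.map (algebraMap K[X] (RatFunc K))).mulVecLin

/-- The left rational null space `{y | yᵀ P = 0}`; the row vector `yᵀ` is given by its entries. -/
def leftNullSpace {m n : ℕ} (P : Matrix (Fin m) (Fin n) K[X]) :
    Submodule (RatFunc K) (Fin m → RatFunc K) :=
  LinearMap.ker (P.map (algebraMap K[X] (RatFunc K))).vecMulLinear

/-- The right minimal indices of a matrix polynomial. -/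
def rightMinimalIndices {m n : ℕ} (P : Matrix (Fin m) (Fin n) K[X]) : Multiset ℕ :=
  minimalIndices (rightNullSpace P)

/-- The left minimal indices of a matrix polynomial. -/
def leftMinimalIndices {m n : ℕ} (P : Matrix (Fin m) (Fin n) K[X]) : Multiset ℕ :=
  minimalIndices (leftNullSpace P)

/-- `P` has grade `g`, that is, it can be written as `∑_{i=0}^g P_i λ^i`. -/
def HasGrade {m n : ℕ} (g : ℕ) (P : Matrix (Fin m) (Fin n) K[X]) : Prop :=
  ∀ r s, (P r s).natDegree ≤ g

/-- A square matrix polynomial is singular if its determinant is identically zero. -/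
def IsSingular {n : ℕ} (P : Matrix (Fin n) (Fin n) K[X]) : Prop :=
  P.det = 0

/-- The Möbius transformation of a scalar polynomial `f = ∑_{i=0}^g f_i λ^i` of grade `g` induced
by `A = [a b; c d]`: the polynomial `∑_{i=0}^g f_i (a λ + b)^i (c λ + d)^(g - i)`. -/
def mobius (A : GL (Fin 2) K) (g : ℕ) (f : K[X]) : K[X] :=
  ∑ i ∈ Finset.range (g + 1),
    C (f.coeff i) * (C (A 0 0) * X + C (A 0 1)) ^ i * (C (A 1 0) * X + C (A 1 1)) ^ (g - i)

/-- The Möbius transformation of a matrix polynomial of grade `g`; it acts entrywise. -/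
def mobiusMatrix {m n : ℕ} (A : GL (Fin 2) K) (g : ℕ) (P : Matrix (Fin m) (Fin n) K[X]) :
    Matrix (Fin m) (Fin n) K[X] :=
  P.map (mobius A g)

/-- The Möbius transformation of a vector polynomial, taken with respect to its degree. -/
def mobiusVec {n : ℕ} (A : GL (Fin 2) K) (x : Fin n → K[X]) : Fin n → K[X] :=
  fun j => mobius A (vecDegree x) (x j)

end Field

section Conjugation

variable {𝕜 : Type*} [RCLike 𝕜]

/-- Entrywise conjugation of a `2 × 2` invertible matrix. -/
def conjGL (A : GL (Fin 2) 𝕜) : GL (Fin 2) 𝕜 :=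
  Matrix.GeneralLinearGroup.map (starRingEnd 𝕜) A

/-- The vector polynomial whose coefficients are the conjugates of those of `x`. -/
def conjVec {n : ℕ} (x : Fin n → 𝕜[X]) : Fin n → 𝕜[X] :=
  fun j => (x j).map (starRingEnd 𝕜)

/-- The matrix polynomial `P^⋆ = ∑ P_i^⋆ λ^i`, whose coefficients are the conjugate transposes
(over `ℝ`, the transposes) of those of `P`. -/
def starMatrix {m n : ℕ} (P : Matrix (Fin m) (Fin n) 𝕜[X]) : Matrix (Fin n) (Fin m) 𝕜[X] :=
  P.transpose.map (Polynomial.map (starRingEnd 𝕜))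

/-- `P`, regarded as a matrix polynomial of grade `g`, is `M_A`-structured. -/
def IsMobiusStructured {n : ℕ} (A : GL (Fin 2) 𝕜) (g : ℕ) (P : Matrix (Fin n) (Fin n) 𝕜[X]) :
    Prop :=
  HasGrade g P ∧ mobiusMatrix A g P = starMatrix P

end Conjugation

end MobiusPoly

end

open MobiusPoly

/-!
The Möbius substitution `φ_A = (a λ + b) / (c λ + d)` combined with conjugation of the coefficients
gives a ring automorphism `σ` of the field of rational functions: `f ↦ (conj f)(φ_A)`
(`conjMobius`, with inverse given by `conj A⁻¹`, `conjMobius_conjGL_inv_apply`). On a polynomial `f`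
of grade `g` it is, up to the nonzero factor `(c λ + d) ^ g`, the Möbius transformation of the
conjugate of `f` (`pow_mul_conjMobius`). Hence `σ` for `conj A`, applied entrywise to an
`M_A`-structured matrix polynomial `P`, gives a nonzero multiple of `Pᵀ`, and so it carries the right
null space of `P` onto the left one (`conjMobius_mem_leftNullSpace_iff`).

Consequently the operation `x ↦ M_A[conj x]`, taken vector by vector, sends polynomial bases of the
right null space to polynomial bases of the left one, and the operation for the inverse
transformation goes back (`IsPolynomialBasis.mobiusVec_conjVec`). Neither of the two operations
raises the degree of a vector (`vecDegree_mobiusVec_conjVec_le`). Comparing orders in both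
directions shows that a minimal basis is sent to a minimal basis
(`IsMobiusStructured.isMinimalBasis_leftNullSpace`) and that no single degree can drop
(`IsMobiusStructured.degrees_mobiusVec_conjVec`), which gives the equality of the minimal indices.
-/

/-! ### The Möbius transformation of a polynomial -/

namespace MobiusPoly

section Field

variable {K : Type*} [Field K]

theorem natDegree_mobius_le (A : GL (Fin 2) K) (g : ℕ) (f : K[X]) :
    (mobius A g f).natDegree ≤ g := by
  refine natDegree_sum_le_of_forall_le _ _ fun i hi => ?_
  have hi' : i ≤ g := Nat.lt_succ_iff.1 (Finset.mem_range.1 hi)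
  have h : ∀ (u v : K) (k : ℕ), ((C u * X + C v) ^ k).natDegree ≤ k := fun u v k => by
    simpa using natDegree_pow_le_of_le k (natDegree_linear_le (a := u) (b := v))
  calc _ ≤ (0 + i) + (g - i) :=
        natDegree_mul_le_of_le (natDegree_mul_le_of_le (natDegree_C _).le (h _ _ _)) (h _ _ _)
    _ = g := by omega

theorem vecDegree_mobiusVec_le {n : ℕ} (A : GL (Fin 2) K) (x : Fin n → K[X]) :
    vecDegree (mobiusVec A x) ≤ vecDegree x :=
  Finset.sup_le fun _ _ => natDegree_mobius_le _ _ _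

theorem natDegree_le_vecDegree {n : ℕ} (x : Fin n → K[X]) (j : Fin n) :
    (x j).natDegree ≤ vecDegree x :=
  Finset.le_sup (f := fun j => (x j).natDegree) (Finset.mem_univ j)

/-- The denominator `c λ + d` of the Möbius substitution induced by `[a b; c d]`. -/
noncomputable def mobiusDenom (A : GL (Fin 2) K) : RatFunc K :=
  RatFunc.C (A 1 0) * RatFunc.X + RatFunc.C (A 1 1)

/-- The rational function `(a λ + b) / (c λ + d)` for `A = [a b; c d]`. -/
noncomputable def mobiusX (A : GL (Fin 2) K) : RatFunc K :=
  (RatFunc.C (A 0 0) * RatFunc.X + RatFunc.C (A 0 1)) / mobiusDenom A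

theorem det_entries_ne_zero (A : GL (Fin 2) K) : A 0 0 * A 1 1 - A 0 1 * A 1 0 ≠ 0 := by
  have h := A.det_ne_zero
  rwa [Matrix.det_fin_two] at h

/-- An affine rational function `u λ + v` vanishes only if both its coefficients do. -/
theorem C_mul_X_add_C_eq_zero {u v : K} (h : RatFunc.C u * RatFunc.X + RatFunc.C v = 0) :
    u = 0 ∧ v = 0 := by
  have h' : algebraMap K[X] (RatFunc K) (C u * X + C v) = 0 := by
    rw [map_add, map_mul, RatFunc.algebraMap_C, RatFunc.algebraMap_C, RatFunc.algebraMap_X, h]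
  have h0 := (map_eq_zero_iff _ (IsFractionRing.injective K[X] (RatFunc K))).1 h'
  exact ⟨by simpa using congrArg (fun f => f.coeff 1) h0,
    by simpa using congrArg (fun f => f.coeff 0) h0⟩

theorem mobiusDenom_ne_zero (A : GL (Fin 2) K) : mobiusDenom A ≠ 0 := fun h => by
  obtain ⟨h1, h2⟩ := C_mul_X_add_C_eq_zero h
  exact det_entries_ne_zero A (by simp [h1, h2])

theorem transcendental_mobiusX (A : GL (Fin 2) K) : Transcendental K (mobiusX A) := by
  refine RatFunc.transcendental_of_ne_C _ ?_
  rintro ⟨r, hr⟩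
  rw [mobiusX, div_eq_iff (mobiusDenom_ne_zero A), mobiusDenom] at hr
  obtain ⟨h1, h2⟩ := C_mul_X_add_C_eq_zero
    (u := A 0 0 - r * A 1 0) (v := A 0 1 - r * A 1 1) (by
      simp only [map_sub, map_mul]
      linear_combination hr)
  exact det_entries_ne_zero A (by linear_combination A 1 1 * h1 - A 1 0 * h2)

/-- The Möbius transformation is the substitution of `(a λ + b) / (c λ + d)`, cleared of its
denominator. -/
theorem algebraMap_mobius (A : GL (Fin 2) K) {g : ℕ} {f : K[X]} (hf : f.natDegree ≤ g) :
    algebraMap K[X] (RatFunc K) (mobius A g f) = mobiusDenom A ^ g * aeval (mobiusX A) f := by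
  have hD := mobiusDenom_ne_zero A
  rw [aeval_eq_sum_range' (Nat.lt_succ_of_le hf), mobius, map_sum, Finset.mul_sum]
  refine Finset.sum_congr rfl fun i hi => ?_
  have hi' : i ≤ g := Nat.lt_succ_iff.1 (Finset.mem_range.1 hi)
  have hs : mobiusDenom A ^ g = mobiusDenom A ^ i * mobiusDenom A ^ (g - i) := by
    rw [← pow_add, Nat.add_sub_cancel' hi']
  simp only [map_mul, map_pow, map_add, RatFunc.algebraMap_C, RatFunc.algebraMap_X]
  rw [← mobiusDenom, hs, mobiusX, div_pow, RatFunc.smul_eq_C_mul]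
  generalize RatFunc.C (A 0 0) * RatFunc.X + RatFunc.C (A 0 1) = N
  have hDi := pow_ne_zero i hD
  field_simp

end Field

/-! ### The automorphism of the rational functions -/

section Conjugation

variable {𝕜 : Type*} [RCLike 𝕜]

theorem injective_aeval_mobiusX_comp_map (A : GL (Fin 2) 𝕜) : Function.Injective
    ((aeval (mobiusX A)).toRingHom.comp (mapRingHom (starRingEnd 𝕜)) : 𝕜[X] →+* RatFunc 𝕜) :=
  (transcendental_iff_injective.1 (transcendental_mobiusX A)).comp
    (map_injective _ (starRingEnd 𝕜).injective)

/-- The semilinear field endomorphism of the rational functions that conjugates the coefficients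
and substitutes `(a λ + b) / (c λ + d)` for `λ`. -/
noncomputable def conjMobius (A : GL (Fin 2) 𝕜) : RatFunc 𝕜 →+* RatFunc 𝕜 :=
  IsFractionRing.lift (injective_aeval_mobiusX_comp_map A)

theorem conjMobius_algebraMap (A : GL (Fin 2) 𝕜) (f : 𝕜[X]) :
    conjMobius A (algebraMap 𝕜[X] (RatFunc 𝕜) f) = aeval (mobiusX A) (f.map (starRingEnd 𝕜)) := by
  simp [conjMobius, IsFractionRing.lift_algebraMap]

theorem conjMobius_C (A : GL (Fin 2) 𝕜) (r : 𝕜) :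
    conjMobius A (RatFunc.C r) = RatFunc.C (starRingEnd 𝕜 r) := by
  rw [← RatFunc.algebraMap_C, conjMobius_algebraMap, map_C, aeval_C, RatFunc.algebraMap_eq_C]

theorem conjMobius_X (A : GL (Fin 2) 𝕜) : conjMobius A RatFunc.X = mobiusX A := by
  rw [← RatFunc.algebraMap_X, conjMobius_algebraMap, map_X, aeval_X]

theorem pow_mul_conjMobius (A : GL (Fin 2) 𝕜) {g : ℕ} {f : 𝕜[X]} (hf : f.natDegree ≤ g) :
    mobiusDenom A ^ g * conjMobius A (algebraMap 𝕜[X] (RatFunc 𝕜) f) =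
      algebraMap 𝕜[X] (RatFunc 𝕜) (mobius A g (f.map (starRingEnd 𝕜))) := by
  rw [conjMobius_algebraMap, algebraMap_mobius A (natDegree_map_le.trans hf)]

theorem conjGL_apply (A : GL (Fin 2) 𝕜) (i j : Fin 2) :
    conjGL A i j = starRingEnd 𝕜 (A i j) := rfl

theorem conjGL_conjGL (A : GL (Fin 2) 𝕜) : conjGL (conjGL A) = A := by
  ext i j
  simp [conjGL_apply]

theorem conjGL_inv (A : GL (Fin 2) 𝕜) : conjGL A⁻¹ = (conjGL A)⁻¹ :=
  map_inv _ _

/-- A ring endomorphism of the rational functions fixing the constants and `λ` is the identity. -/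
theorem ratFunc_ringHom_apply_eq_self {K : Type*} [Field K] (φ : RatFunc K →+* RatFunc K)
    (hC : ∀ r, φ (RatFunc.C r) = RatFunc.C r) (hX : φ RatFunc.X = RatFunc.X) (v : RatFunc K) :
    φ v = v := by
  have h : φ = RingHom.id _ := by
    refine IsLocalization.ringHom_ext (nonZeroDivisors K[X]) (Polynomial.ringHom_ext ?_ ?_)
    · intro r
      simp [hC]
    · simp [hX]
  rw [h, RingHom.id_apply]

theorem conjMobius_conjGL_inv_apply (A : GL (Fin 2) 𝕜) (v : RatFunc 𝕜) :
    conjMobius A (conjMobius (conjGL A⁻¹) v) = v := by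
  refine ratFunc_ringHom_apply_eq_self ((conjMobius A).comp (conjMobius (conjGL A⁻¹)))
    (fun r => by simp [conjMobius_C]) ?_ v
  have hmul : ∀ i j, A⁻¹ i 0 * A 0 j + A⁻¹ i 1 * A 1 j = (1 : Matrix (Fin 2) (Fin 2) 𝕜) i j := by
    intro i j
    have h : ((A⁻¹ * A : GL (Fin 2) 𝕜) : Matrix (Fin 2) (Fin 2) 𝕜) i j =
        A⁻¹ i 0 * A 0 j + A⁻¹ i 1 * A 1 j := by
      rw [Matrix.GeneralLinearGroup.coe_mul, Matrix.mul_apply, Fin.sum_univ_two]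
    rw [← h, inv_mul_cancel, Matrix.GeneralLinearGroup.coe_one]
  have hC : ∀ i j, RatFunc.C (A⁻¹ i 0) * RatFunc.C (A 0 j) + RatFunc.C (A⁻¹ i 1) * RatFunc.C (A 1 j)
      = RatFunc.C ((1 : Matrix (Fin 2) (Fin 2) 𝕜) i j) := by
    intro i j
    rw [← hmul, map_add, map_mul, map_mul]
  have h00 := hC 0 0
  have h01 := hC 0 1
  have h10 := hC 1 0
  have h11 := hC 1 1
  simp only [Matrix.one_apply_eq, ne_eq, zero_ne_one, one_ne_zero, not_false_eq_true,
    Matrix.one_apply_ne, map_zero, map_one] at h00 h01 h10 h11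
  have hD := mobiusDenom_ne_zero A
  have hXD : mobiusX A * mobiusDenom A =
      RatFunc.C (A 0 0) * RatFunc.X + RatFunc.C (A 0 1) := div_mul_cancel₀ _ hD
  have hden : RatFunc.C (A⁻¹ 1 0) * mobiusX A + RatFunc.C (A⁻¹ 1 1) = (mobiusDenom A)⁻¹ := by
    refine eq_inv_of_mul_eq_one_left ?_
    rw [add_mul, mul_assoc, hXD, mobiusDenom]
    linear_combination RatFunc.X * h10 + h11
  have hnum : RatFunc.C (A⁻¹ 0 0) * mobiusX A + RatFunc.C (A⁻¹ 0 1) =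
      RatFunc.X * (mobiusDenom A)⁻¹ := by
    rw [eq_mul_inv_iff_mul_eq₀ hD, add_mul, mul_assoc, hXD, mobiusDenom]
    linear_combination RatFunc.X * h00 + h01
  rw [RingHom.comp_apply, conjMobius_X, mobiusX, mobiusDenom]
  simp only [map_div₀, map_add, map_mul, conjMobius_C, conjMobius_X, conjGL_apply, RCLike.conj_conj]
  rw [hden, hnum, mul_div_cancel_right₀ _ (inv_ne_zero hD)]

/-! ### Transport of polynomial bases -/

theorem vecDegree_mobiusVec_conjVec_le {n : ℕ} (A : GL (Fin 2) 𝕜) (x : Fin n → 𝕜[X]) :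
    vecDegree (mobiusVec A (conjVec x)) ≤ vecDegree x :=
  (vecDegree_mobiusVec_le _ _).trans (Finset.sup_mono_fun fun _ _ => natDegree_map_le)

theorem vecDegree_conjVec {n : ℕ} (x : Fin n → 𝕜[X]) : vecDegree (conjVec x) = vecDegree x := by
  simp [vecDegree, conjVec, natDegree_map]

theorem toRat_mobiusVec_conjVec {n : ℕ} (A : GL (Fin 2) 𝕜) (x : Fin n → 𝕜[X]) :
    toRat (mobiusVec A (conjVec x)) =
      mobiusDenom A ^ vecDegree x • fun j => conjMobius A (toRat x j) := by
  funext j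
  simp only [toRat, mobiusVec, vecDegree_conjVec, Pi.smul_apply, smul_eq_mul]
  rw [pow_mul_conjMobius A (natDegree_le_vecDegree x j), conjVec]

/-- If the automorphism `f ↦ (conj f)(φ_A)` carries `V` onto `W`, then `x ↦ M_A[conj x]` carries the
polynomial bases of `V` to polynomial bases of `W`. -/
theorem IsPolynomialBasis.mobiusVec_conjVec {n p : ℕ} (A : GL (Fin 2) 𝕜)
    {V W : Submodule (RatFunc 𝕜) (Fin n → RatFunc 𝕜)}
    (hVW : ∀ v : Fin n → RatFunc 𝕜, (fun j => conjMobius A (v j)) ∈ W ↔ v ∈ V)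
    {x : Fin p → Fin n → 𝕜[X]} (hx : IsPolynomialBasis V x) :
    IsPolynomialBasis W fun i => mobiusVec A (conjVec (x i)) := by
  obtain ⟨hli, hsp⟩ := hx
  let u : Fin p → (RatFunc 𝕜)ˣ := fun i =>
    Units.mk0 _ (pow_ne_zero (vecDegree (x i)) (mobiusDenom_ne_zero A))
  have hu : (fun i => toRat (mobiusVec A (conjVec (x i)))) =
      u • fun i j => conjMobius A (toRat (x i) j) := by
    funext i
    rw [toRat_mobiusVec_conjVec]
    rfl
  have hy : ∀ i, (fun j => conjMobius A (toRat (x i) j)) ∈ Submodule.span (RatFunc 𝕜)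
      (Set.range fun i => toRat (mobiusVec A (conjVec (x i)))) := fun i => by
    have h := Submodule.smul_mem _ ((u i)⁻¹ : RatFunc 𝕜) (Submodule.subset_span ⟨i, rfl⟩ :
      (fun i => toRat (mobiusVec A (conjVec (x i)))) i ∈ Submodule.span (RatFunc 𝕜)
        (Set.range fun i => toRat (mobiusVec A (conjVec (x i)))))
    rw [hu] at h
    rw [hu]
    simpa [Units.smul_def, smul_smul] using h
  refine ⟨?_, le_antisymm ?_ ?_⟩
  · rw [hu]
    refine LinearIndependent.units_smul ?_ u
    exact hli.map_of_surjective_injective (conjMobius A)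
      ((conjMobius A).toAddMonoidHom.compLeft (Fin n))
      (fun v => ⟨_, conjMobius_conjGL_inv_apply A v⟩)
      (fun v hv => funext fun j => (map_eq_zero (conjMobius A)).1 (congrFun hv j))
      (fun r v => funext fun j => map_mul (conjMobius A) r (v j))
  · rw [Submodule.span_le]
    rintro _ ⟨i, rfl⟩
    dsimp only
    rw [toRat_mobiusVec_conjVec]
    exact W.smul_mem _ ((hVW _).2 (hsp ▸ Submodule.subset_span ⟨i, rfl⟩))
  · intro w hw
    -- Pull `w` back to `V`, expand it in the given basis, and push the expansion forward.
    have hwv : (fun j => conjMobius A (conjMobius (conjGL A⁻¹) (w j))) = w :=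
      funext fun j => conjMobius_conjGL_inv_apply A (w j)
    have hv : (fun j => conjMobius (conjGL A⁻¹) (w j)) ∈ V := (hVW _).1 (by rwa [hwv])
    rw [← hsp, Submodule.mem_span_range_iff_exists_fun] at hv
    obtain ⟨c, hc⟩ := hv
    have hwc : w = ∑ i, conjMobius A (c i) • fun j => conjMobius A (toRat (x i) j) := by
      funext j
      have h := congrArg (conjMobius A) (congrFun hc j)
      rw [conjMobius_conjGL_inv_apply] at h
      rw [← h]
      simp [Finset.sum_apply]
    rw [hwc]
    exact Submodule.sum_mem _ fun i _ => Submodule.smul_mem _ _ (hy i)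

/-! ### Null spaces of structured matrix polynomials -/

/-- Taking conjugates in `M_A[P] = P^⋆`: the Möbius transformation induced by the conjugate of `A`
sends the conjugate of `P` to the transpose of `P`. -/
theorem IsMobiusStructured.mobius_conjGL_map {n : ℕ} {A : GL (Fin 2) 𝕜} {g : ℕ}
    {P : Matrix (Fin n) (Fin n) 𝕜[X]} (hP : IsMobiusStructured A g P) (r s : Fin n) :
    mobius (conjGL A) g ((P r s).map (starRingEnd 𝕜)) = P s r := by
  have h : mobius A g (P r s) = (P s r).map (starRingEnd 𝕜) := congrFun (congrFun hP.2 r) s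
  have h' := congrArg (Polynomial.map (starRingEnd 𝕜)) h
  rw [Polynomial.map_map, show (starRingEnd 𝕜).comp (starRingEnd 𝕜) = RingHom.id 𝕜 from
    RingHom.ext RCLike.conj_conj, Polynomial.map_id] at h'
  rw [← h']
  simp [mobius, Polynomial.map_sum, conjGL_apply]

theorem conjMobius_mem_leftNullSpace_iff {n : ℕ} {A : GL (Fin 2) 𝕜} {g : ℕ}
    {P : Matrix (Fin n) (Fin n) 𝕜[X]} (hP : IsMobiusStructured A g P) (v : Fin n → RatFunc 𝕜) :
    (fun j => conjMobius (conjGL A) (v j)) ∈ leftNullSpace P ↔ v ∈ rightNullSpace P := by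
  have hentry : ∀ r, Matrix.vecMul (fun j => conjMobius (conjGL A) (v j))
      (P.map (algebraMap 𝕜[X] (RatFunc 𝕜))) r = mobiusDenom (conjGL A) ^ g *
        conjMobius (conjGL A) (Matrix.mulVec (P.map (algebraMap 𝕜[X] (RatFunc 𝕜))) v r) := by
    intro r
    simp only [Matrix.vecMul, Matrix.mulVec, dotProduct, map_sum, map_mul, Finset.mul_sum,
      Matrix.map_apply]
    refine Finset.sum_congr rfl fun s _ => ?_
    rw [← mul_assoc, pow_mul_conjMobius _ (hP.1 r s), hP.mobius_conjGL_map, mul_comm]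
  simp only [leftNullSpace, rightNullSpace, LinearMap.mem_ker, Matrix.vecMulLinear_apply,
    Matrix.mulVecLin_apply, funext_iff, hentry, Pi.zero_apply, mul_eq_zero, map_eq_zero,
    pow_ne_zero g (mobiusDenom_ne_zero (conjGL A)), false_or]

theorem conjMobius_mem_rightNullSpace_iff {n : ℕ} {A : GL (Fin 2) 𝕜} {g : ℕ}
    {P : Matrix (Fin n) (Fin n) 𝕜[X]} (hP : IsMobiusStructured A g P) (w : Fin n → RatFunc 𝕜) :
    (fun j => conjMobius A⁻¹ (w j)) ∈ rightNullSpace P ↔ w ∈ leftNullSpace P := by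
  rw [← conjMobius_mem_leftNullSpace_iff hP]
  have h : ∀ j, conjMobius (conjGL A) (conjMobius A⁻¹ (w j)) = w j := fun j => by
    have h := conjMobius_conjGL_inv_apply (conjGL A) (w j)
    rwa [← conjGL_inv, conjGL_conjGL] at h
  simp only [h]

theorem order_mobiusVec_conjVec_le {n p : ℕ} (A : GL (Fin 2) 𝕜) (x : Fin p → Fin n → 𝕜[X]) :
    order (fun i => mobiusVec A (conjVec (x i))) ≤ order x :=
  Finset.sum_le_sum fun i _ => vecDegree_mobiusVec_conjVec_le A (x i)

theorem IsMobiusStructured.isMinimalBasis_leftNullSpace {n p : ℕ} {A : GL (Fin 2) 𝕜} {g : ℕ}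
    {P : Matrix (Fin n) (Fin n) 𝕜[X]} (hP : IsMobiusStructured A g P)
    {x : Fin p → Fin n → 𝕜[X]} (hx : IsMinimalBasis (rightNullSpace P) x) :
    IsMinimalBasis (leftNullSpace P) fun i => mobiusVec (conjGL A) (conjVec (x i)) := by
  refine ⟨hx.1.mobiusVec_conjVec _ (conjMobius_mem_leftNullSpace_iff hP), fun q z hz => ?_⟩
  exact (order_mobiusVec_conjVec_le _ x).trans
    ((hx.2 q _ (hz.mobiusVec_conjVec _ (conjMobius_mem_rightNullSpace_iff hP))).trans
      (order_mobiusVec_conjVec_le _ z))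

/-- For a minimal basis no degree drops: transforming back would otherwise give a basis of smaller
order. -/
theorem IsMobiusStructured.degrees_mobiusVec_conjVec {n p : ℕ} {A : GL (Fin 2) 𝕜} {g : ℕ}
    {P : Matrix (Fin n) (Fin n) 𝕜[X]} (hP : IsMobiusStructured A g P)
    {x : Fin p → Fin n → 𝕜[X]} (hx : IsMinimalBasis (rightNullSpace P) x) :
    degrees (fun i => mobiusVec (conjGL A) (conjVec (x i))) = degrees x := by
  have hy := hx.1.mobiusVec_conjVec _ (conjMobius_mem_leftNullSpace_iff hP)
  have hle := (hx.2 p _ (hy.mobiusVec_conjVec _ (conjMobius_mem_rightNullSpace_iff hP))).trans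
    (order_mobiusVec_conjVec_le _ _)
  have heq := (Finset.sum_eq_sum_iff_of_le fun i _ =>
    vecDegree_mobiusVec_conjVec_le (conjGL A) (x i)).1
      ((order_mobiusVec_conjVec_le (conjGL A) x).antisymm hle)
  exact Multiset.map_congr rfl fun i _ => heq i (Finset.mem_univ i)

end Conjugation

end MobiusPoly

theorem mainTheorem7 {𝕜 : Type*} [RCLike 𝕜] {n : ℕ} (A : GL (Fin 2) 𝕜) (g : ℕ)
    (P : Matrix (Fin n) (Fin n) 𝕜[X]) (hsing : IsSingular P) (hP : IsMobiusStructured A g P) :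
    rightMinimalIndices P = leftMinimalIndices P ∧
      ∀ (p : ℕ) (x : Fin p → Fin n → 𝕜[X]), IsMinimalBasis (rightNullSpace P) x →
        IsMinimalBasis (leftNullSpace P) (fun i => mobiusVec (conjGL A) (conjVec (x i))) := by
  refine ⟨?_, fun p x hx => hP.isMinimalBasis_leftNullSpace hx⟩
  obtain ⟨p, x, hx⟩ := exists_isMinimalBasis (rightNullSpace P)
  rw [rightMinimalIndices, leftMinimalIndices, ← hx.degrees_eq_minimalIndices,
    ← (hP.isMinimalBasis_leftNullSpace hx).degrees_eq_minimalIndices,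
    hP.degrees_mobiusVec_conjVec hx]
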